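/- A \emph{generalized non-crossing tree} (GNC-tree) on $n+1$ vertices is a tree whose vertices are $n+1$ points $v_0,v_1,\dots,v_n$ placed in counterclockwise order on a circle, whose edges are straight chords that do not cross, together with positive integer labels of the vertices such that the labels weakly increase, $\ell(v_0)\le \ell(v_1)\le\dots\le \ell(v_n)$, and such that whenever $j$ is a label, every $i$ with $1\le i\le j$ is also a label (so $\ell(v_0)=1$). The tree is rooted at $v_0$. Let $\mathsf{GNC}_n$ be the set of these trees. Direct every edge away from the root. An edge from a vertex labelled $i$ to a vertex labelled $j$ is an ascent ($u$) if $i<j$, a level ($h$) if $i=j$, and a descent ($d$) if $i>j$. Let $u(T),h(T),d(T)$ be the numbers of ascents, levels and descents of $T$. Each path starting at the root is encoded by the word on $\{u,h,d\}$ formed by its successive edges. For a set $P$ of words, $T$ is $P$-avoiding if no word of $P$ occurs as a block of consecutive letters in the word of a path of $T$ starting at the root. Let $\mathsf{GNC}_n(P)$ be the set of $P$-avoiding trees in $\mathsf{GNC}_n$. Define the formal power series (with $0^0=1$) $$T_{x,y,z}(t)=\sum_{n\ge0}t^n\sum_{T\in\mathsf{GNC}_n}x^{u(T)}y^{h(T)}z^{d(T)},\qquad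 T^{P}_{x,y,z}(t)=\sum_{n\ge0}t^n\sum_{T\in\mathsf{GNC}_n(P)}x^{u(T)}y^{h(T)}z^{d(T)} .$$ \textbf{Proposition.} Let $P=\{uu,dd\}$. The generating function $T^{P}_{1,1,1}(t)=\sum_{n\ge0}|\mathsf{GNC}_n(P)|\,t^n$ of $\{uu,dd\}$-avoiding GNC-trees satisfies $$T_{1,1,1}^{P}(t)=\Big\{1+t\,T_{0,1,0}(t)^2\,T_{1,1,1}^{P}(t)\Big\}\Big\{1-t\,T_{0,1,0}(t)^2+2t\,T_{1,1,1}^{P}(t)^2\Big\}.$$ -/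

import Mathlib

namespace GNC

/-- The three kinds of edges, read away from the root: `u` (ascent), `h` (level), `d` (descent). -/
inductive Letter : Type
  | u
  | h
  | d

/-- The letter of an edge traversed from a vertex with label `i` to a vertex with label `j`. -/
def letter (i j : ℕ) : Letter :=
  if i < j then Letter.u else if i = j then Letter.h else Letter.d

/-- A rooted generalized non-crossing tree on `n + 1` vertices. The vertices `0, 1, …, n` are the
points of the circle in counterclockwise order, starting at the root `0`, which is the first
point with label `1`. -/
@[ext]
structure Tree (n : ℕ) where
  /-- the underlying tree -/
  graph : SimpleGraph (Fin (n + 1))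
  /-- the labels of the vertices -/
  label : Fin (n + 1) → ℕ
  isTree : graph.IsTree
  /-- no two chords `ac` and `be` of the circle cross -/
  noncrossing : ∀ a b c e : Fin (n + 1), a < b → b < c → c < e →
    ¬ (graph.Adj a c ∧ graph.Adj b e)
  /-- labels weakly increase in counterclockwise order -/
  label_mono : Monotone label
  label_pos : ∀ v, 1 ≤ label v
  /-- if `label v` is a label, so is every `i` with `1 ≤ i ≤ label v` -/
  label_closed : ∀ v i, 1 ≤ i → i ≤ label v → ∃ w, label w = i

namespace Tree

variable {n : ℕ}

theorem label_le (T : Tree n) (v : Fin (n + 1)) : T.label v ≤ n + 1 := by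
  classical
  have hsub : Finset.Icc 1 (T.label v) ⊆ Finset.univ.image T.label := by
    intro i hi
    rw [Finset.mem_Icc] at hi
    obtain ⟨w, hw⟩ := T.label_closed v i hi.1 hi.2
    exact Finset.mem_image.2 ⟨w, Finset.mem_univ _, hw⟩
  have h1 := Finset.card_le_card hsub
  have h2 := Finset.card_image_le (s := (Finset.univ : Finset (Fin (n + 1)))) (f := T.label)
  simp only [Nat.card_Icc, Finset.card_univ, Fintype.card_fin] at h1 h2
  omega

instance : Finite (Tree n) := by
  let f : Tree n → SimpleGraph (Fin (n + 1)) × (Fin (n + 1) → Fin (n + 2)) :=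
    fun T => (T.graph, fun v => ⟨T.label v, Nat.lt_succ_of_le (T.label_le v)⟩)
  refine Finite.of_injective f ?_
  intro S T hST
  have h1 : S.graph = T.graph := congrArg Prod.fst hST
  have h2 := congrArg Prod.snd hST
  refine Tree.ext h1 (funext fun v => ?_)
  exact congrArg Fin.val (congrFun h2 v)

noncomputable instance : Fintype (Tree n) := Fintype.ofFinite _

/-- The word on `{u, h, d}` that encodes a walk. -/
def word (T : Tree n) : {a b : Fin (n + 1)} → T.graph.Walk a b → List Letter
  | _, _, SimpleGraph.Walk.nil => []
  | _, _, @SimpleGraph.Walk.cons _ _ a b _ _ p => letter (T.label a) (T.label b) :: T.word p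

/-- `T` contains the pattern `σ`: some path starting at the root is encoded by a word in which
`σ` occurs as a block of consecutive letters. -/
def Contains (T : Tree n) (σ : List Letter) : Prop :=
  ∃ (v : Fin (n + 1)) (p : T.graph.Walk 0 v), p.IsPath ∧ σ <:+: T.word p

/-- `T` avoids all the patterns in `P`. -/
def Avoids (T : Tree n) (P : Set (List Letter)) : Prop :=
  ∀ σ ∈ P, ¬ T.Contains σ

/-- `(a, b)` is an edge of `T` directed away from the root: `a` is on the path from the root
to `b`. -/
def Arc (T : Tree n) (a b : Fin (n + 1)) : Prop :=
  T.graph.Adj a b ∧ ∃ p : T.graph.Walk 0 b, p.IsPath ∧ a ∈ p.support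

/-- The number of edges of `T` of kind `s`: the number of ascents, levels or descents. -/
noncomputable def count (T : Tree n) (s : Letter) : ℕ :=
  {e : Fin (n + 1) × Fin (n + 1) |
    T.Arc e.1 e.2 ∧ letter (T.label e.1) (T.label e.2) = s}.ncard

end Tree

open Classical in
/-- The generating function `T_{x,y,z}^P(t) = ∑ₙ tⁿ ∑_T x^{u(T)} y^{h(T)} z^{d(T)}`, where `T` runs
over the trees on `n + 1` vertices that avoid all patterns in `P`, as a formal power series. -/
noncomputable def genFun (P : Set (List Letter)) (x y z : ℤ) : PowerSeries ℤ :=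
  PowerSeries.mk fun n => ∑ T : Tree n with T.Avoids P,
    x ^ T.count Letter.u * y ^ T.count Letter.h * z ^ T.count Letter.d

/-- The pattern set `{uu, dd}`. -/
def uuDd : Set (List Letter) :=
  {[Letter.u, Letter.u], [Letter.d, Letter.d]}

end GNC

/-! Labels start at 1 and rise by 0 or 1 from a vertex to the next, so a GNC-tree is a noncrossing
tree with a set of marked gaps between neighbouring vertices. Let c be the last child of the root 0.
Deleting the edge 0c leaves components [0,m] and [m+1,n], and the second splits at c into [m+1,c]
and [c,n]. Each piece is rooted at an end of its interval. Reflecting the middle one gives three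
trees R, L, W of the original kind, plus one bit for the gap between m and m+1. Iterating gives a
bijection with `Code` (`Code.toTree_injective`, `Tree.exists_code`).

Reflection exchanges ascents and descents, so avoiding both uu and dd is inherited by all three
pieces. The only new condition sits at 0 → c, which is never a descent: if it is an ascent, no
ascent may leave c inside W. It is level exactly when R and L have constant labels and the bit is 0
(`Code.good_node`). Let T, S, N be the series of good codes, of good codes with no ascent at the
root, and of codes with constant labels. Then S = 1 + tN²T and T = 1 + 2tT²S + tN²(T − S), where T −
S accounts for the W that have an ascent at their root. Together they give T = S(1 − tN² + 2tT²),
which is the claim once N is identified with T_{0,1,0}. -/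

namespace GNC

/-! ### Codes, and their recovery from edges and marked gaps -/

/-- Ternary trees with a bit at every internal node. They encode the rooted trees on an interval
whose root is the leftmost vertex: `R`, the mirror image of `L`, and `W` are the pieces that remain
when the edge from the root to its last child is removed and the tree is split at that child. The
bit tells whether the label jumps between the piece of `R` and that of `L`. -/
inductive Code : Type
  | leaf
  | node (R : Code) (b : Bool) (L W : Code)

namespace Code

/-- The number of edges of the encoded tree. -/
def size : Code → ℕ
  | leaf => 0
  | node R _ L W => R.size + L.size + W.size + 1

/-- The edges of the encoded tree on `0, 1, …, size`, directed away from the root `0`. -/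
def Arc : Code → ℤ → ℤ → Prop
  | leaf, _, _ => False
  | node R _ L W, x, y =>
    R.Arc x y ∨ (x = 0 ∧ y = R.size + L.size + 1) ∨
      L.Arc (R.size + L.size + 1 - x) (R.size + L.size + 1 - y) ∨
      W.Arc (x - (R.size + L.size + 1)) (y - (R.size + L.size + 1))

/-- `k.Bar i` tells that the label jumps between the vertices `i` and `i + 1`. -/
def Bar : Code → ℤ → Prop
  | leaf, _ => False
  | node R b L W, i =>
    -- With c = `R.size + L.size + 1`, the gap between i and i + 1 lies between c - i - 1 and c - i
    -- in the reflected coordinates of `L`, hence the missing + 1.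
    R.Bar i ∨ (i = R.size ∧ b = true) ∨ L.Bar (R.size + L.size - i) ∨
      W.Bar (i - (R.size + L.size + 1))

/-- The undirected edges of the encoded tree. -/
def Edge (k : Code) (x y : ℤ) : Prop := k.Arc x y ∨ k.Arc y x

theorem Edge.symm {k : Code} {x y : ℤ} (h : k.Edge x y) : k.Edge y x := Or.symm h

theorem Arc.range {k : Code} {x y : ℤ} (h : k.Arc x y) :
    0 ≤ x ∧ x ≤ k.size ∧ 1 ≤ y ∧ y ≤ k.size := by
  induction k generalizing x y with
  | leaf => exact h.elim
  | node R b L W hR hL hW =>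
    simp only [size]
    rcases h with h | h | h | h
    · have := hR h; omega
    · omega
    · have := hL h; omega
    · have := hW h; omega

theorem Bar.range {k : Code} {i : ℤ} (h : k.Bar i) : 0 ≤ i ∧ i < k.size := by
  induction k generalizing i with
  | leaf => exact h.elim
  | node R b L W hR hL hW =>
    simp only [size]
    rcases h with h | h | h | h
    · have := hR h; omega
    · omega
    · have := hL h; omega
    · have := hW h; omega

theorem Edge.range {k : Code} {x y : ℤ} (h : k.Edge x y) :
    0 ≤ x ∧ x ≤ k.size ∧ 0 ≤ y ∧ y ≤ k.size := by
  rcases h with h | h <;> have := h.range <;> omega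

/-- With the ranges attached, the heads y of the four cases lie in disjoint sets, so `omega` can
discard incompatible cases in the inductions below. -/
theorem arc_node {R L W : Code} {b : Bool} {x y : ℤ} (h : (node R b L W).Arc x y) :
    (R.Arc x y ∧ 0 ≤ x ∧ x ≤ R.size ∧ 1 ≤ y ∧ y ≤ R.size) ∨
    (x = 0 ∧ y = R.size + L.size + 1) ∨
    (L.Arc (R.size + L.size + 1 - x) (R.size + L.size + 1 - y) ∧
      R.size + 1 ≤ x ∧ x ≤ R.size + L.size + 1 ∧ R.size + 1 ≤ y ∧ y < R.size + L.size + 1) ∨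
    (W.Arc (x - (R.size + L.size + 1)) (y - (R.size + L.size + 1)) ∧
      R.size + L.size + 1 ≤ x ∧ x ≤ R.size + L.size + W.size + 1 ∧
      R.size + L.size + 1 < y ∧ y ≤ R.size + L.size + W.size + 1) := by
  rcases h with h | h | h | h
  · exact Or.inl ⟨h, h.range⟩
  · exact Or.inr (Or.inl h)
  · have := h.range
    exact Or.inr (Or.inr (Or.inl ⟨h, by omega⟩))
  · have := h.range
    exact Or.inr (Or.inr (Or.inr ⟨h, by omega⟩))

theorem edge_node {R L W : Code} {b : Bool} {x y : ℤ} (h : (node R b L W).Edge x y) :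
    (R.Edge x y ∧ 0 ≤ x ∧ x ≤ R.size ∧ 0 ≤ y ∧ y ≤ R.size) ∨
    (x = 0 ∧ y = R.size + L.size + 1) ∨ (y = 0 ∧ x = R.size + L.size + 1) ∨
    (L.Edge (R.size + L.size + 1 - x) (R.size + L.size + 1 - y) ∧
      R.size + 1 ≤ x ∧ x ≤ R.size + L.size + 1 ∧ R.size + 1 ≤ y ∧ y ≤ R.size + L.size + 1) ∨
    (W.Edge (x - (R.size + L.size + 1)) (y - (R.size + L.size + 1)) ∧
      R.size + L.size + 1 ≤ x ∧ x ≤ R.size + L.size + W.size + 1 ∧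
      R.size + L.size + 1 ≤ y ∧ y ≤ R.size + L.size + W.size + 1) := by
  rcases h with h | h <;> rcases arc_node h with ⟨h, h'⟩ | h | ⟨h, h'⟩ | ⟨h, h'⟩
  · exact Or.inl ⟨Or.inl h, by omega⟩
  · exact Or.inr (Or.inl h)
  · exact Or.inr (Or.inr (Or.inr (Or.inl ⟨Or.inl h, by omega⟩)))
  · exact Or.inr (Or.inr (Or.inr (Or.inr ⟨Or.inl h, by omega⟩)))
  · exact Or.inl ⟨Or.inr h, by omega⟩
  · exact Or.inr (Or.inr (Or.inl h))
  · exact Or.inr (Or.inr (Or.inr (Or.inl ⟨Or.inr h, by omega⟩)))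
  · exact Or.inr (Or.inr (Or.inr (Or.inr ⟨Or.inr h, by omega⟩)))

theorem edge_node_left {R L W : Code} {b : Bool} {x y : ℤ} (h : R.Edge x y) :
    (node R b L W).Edge x y := h.imp Or.inl Or.inl

theorem edge_node_mid {R L W : Code} {b : Bool} {x y : ℤ}
    (h : L.Edge (R.size + L.size + 1 - x) (R.size + L.size + 1 - y)) :
    (node R b L W).Edge x y :=
  h.imp (fun h => Or.inr (Or.inr (Or.inl h))) (fun h => Or.inr (Or.inr (Or.inl h)))

theorem edge_node_right {R L W : Code} {b : Bool} {x y : ℤ}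
    (h : W.Edge (x - (R.size + L.size + 1)) (y - (R.size + L.size + 1))) :
    (node R b L W).Edge x y :=
  h.imp (fun h => Or.inr (Or.inr (Or.inr h))) (fun h => Or.inr (Or.inr (Or.inr h)))

theorem edge_node_root {R L W : Code} {b : Bool} :
    (node R b L W).Edge 0 (R.size + L.size + 1) := Or.inl (Or.inr (Or.inl ⟨rfl, rfl⟩))

theorem Arc.parent_unique {k : Code} {x x' y : ℤ} (h : k.Arc x y) (h' : k.Arc x' y) :
    x = x' := by
  induction k generalizing x x' y with
  | leaf => exact h.elim
  | node R b L W hR hL hW =>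
    rcases arc_node h with ⟨h, _⟩ | h | ⟨h, _⟩ | ⟨h, _⟩ <;>
      rcases arc_node h' with ⟨h', _⟩ | h' | ⟨h', _⟩ | ⟨h', _⟩ <;> try omega
    · exact hR h h'
    · have := hL h h'; omega
    · have := hW h h'; omega

theorem Arc.not_symm {k : Code} {x y : ℤ} (h : k.Arc x y) : ¬ k.Arc y x := by
  intro h'
  induction k generalizing x y with
  | leaf => exact h.elim
  | node R b L W hR hL hW =>
    rcases arc_node h with ⟨h, _⟩ | h | ⟨h, _⟩ | ⟨h, _⟩ <;>
      rcases arc_node h' with ⟨h', _⟩ | h' | ⟨h', _⟩ | ⟨h', _⟩ <;> try omega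
    · exact hR h h'
    · exact hL h h'
    · exact hW h h'

theorem Edge.ne {k : Code} {x y : ℤ} (h : k.Edge x y) : x ≠ y := by
  rintro rfl
  exact h.elim (fun h => h.not_symm h) (fun h => h.not_symm h)

theorem noncrossing {k : Code} {p q r s : ℤ} (hpq : p < q) (hqr : q < r) (hrs : r < s)
    (h : k.Edge p r) (h' : k.Edge q s) : False := by
  induction k generalizing p q r s with
  | leaf => exact h.elim id id
  | node R b L W hR hL hW =>
    rcases edge_node h with ⟨h, _⟩ | h | h | ⟨h, _⟩ | ⟨h, _⟩ <;>
      rcases edge_node h' with ⟨h', _⟩ | h' | h' | ⟨h', _⟩ | ⟨h', _⟩ <;> try omega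
    · exact hR hpq hqr hrs h h'
    -- Reflection reverses the order, so the two chords exchange roles.
    · exact hL (by omega) (by omega) (by omega) h'.symm h.symm
    · exact hW (by omega) (by omega) (by omega) h h'

open Relation in
theorem reach (k : Code) {x : ℤ} (h0 : 0 ≤ x) (hx : x ≤ k.size) :
    ReflTransGen k.Arc 0 x := by
  induction k generalizing x with
  | leaf =>
    have : x = 0 := by simp only [size] at hx; omega
    rw [this]
  | node R b L W hR hL hW =>
    have hc : ReflTransGen (node R b L W).Arc 0 (R.size + L.size + 1) :=
      ReflTransGen.single (Or.inr (Or.inl ⟨rfl, rfl⟩))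
    simp only [size] at hx
    by_cases h1 : x ≤ R.size
    · exact ReflTransGen.mono (fun _ _ h => Or.inl h) _ _ (hR h0 h1)
    by_cases h2 : x ≤ R.size + L.size + 1
    · refine hc.trans ?_
      have := (hL (x := R.size + L.size + 1 - x) (by omega) (by omega)).lift
        (p := (node R b L W).Arc) (fun y => R.size + L.size + 1 - y) fun y z h =>
          Or.inr (Or.inr (Or.inl (by simpa using h)))
      simpa [Function.onFun] using this
    · refine hc.trans ?_
      have := (hW (x := x - (R.size + L.size + 1)) (by omega) (by omega)).lift
        (p := (node R b L W).Arc) (fun y => y + (R.size + L.size + 1)) fun y z h =>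
          Or.inr (Or.inr (Or.inr (by simpa using h)))
      simpa [Function.onFun] using this

end Code

open Relation in
-- A chain that leaves a set has a step across its boundary. It serves to find an edge straddling a
-- cut of the interval.
theorem exists_step {α : Type*} {r : α → α → Prop} {a b : α} (h : ReflTransGen r a b)
    (P : α → Prop) (ha : P a) (hb : ¬ P b) :
    ∃ x y, ReflTransGen r a x ∧ r x y ∧ P x ∧ ¬ P y := by
  induction h with
  | refl => exact absurd ha hb
  | @tail x y hx hxy ih =>
    by_cases hP : P x
    · exact ⟨x, y, hx, hxy, hP, hb⟩
    · exact ih hP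

namespace Code
open Relation in
-- If `R'` reached beyond `R`, then, being connected, it would have an edge across the cut after
-- `R.size`. The only edge of the other tree across that cut ends at c, which lies outside `R'`.
theorem left_size_le {R L W R' L' W' : Code} {b b' : Bool}
    (hc : R.size + L.size = R'.size + L'.size)
    (hE : ∀ x y, (node R b L W).Edge x y ↔ (node R' b' L' W').Edge x y) :
    R'.size ≤ R.size := by
  by_contra! hlt
  obtain ⟨x, y, -, hxy, hx, hy⟩ := exists_step
    (R'.reach (x := R.size + 1) (by omega) (by omega)) (fun x => x ≤ R.size) (by omega) (by omega)
  have hr := hxy.range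
  rcases edge_node ((hE x y).2 (edge_node_left (Or.inl hxy))) with h | h | h | h | h <;> omega

/-- Distinct pieces share at most the vertex c, and no edge joins c to itself. So each piece is the
restriction of the tree to its interval, here and in the two analogues below. -/
theorem edge_left_iff {R L W : Code} (b : Bool) {x y : ℤ} :
    R.Edge x y ↔ x ≤ R.size ∧ y ≤ R.size ∧ (node R b L W).Edge x y := by
  refine ⟨fun h => ⟨h.range.2.1, h.range.2.2.2, edge_node_left h⟩, fun ⟨hx, hy, h⟩ => ?_⟩
  have hn := h.ne
  rcases edge_node h with h | h | h | h | h <;> first | exact h.1 | omega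

theorem edge_mid_iff {R L W : Code} (b : Bool) {x y : ℤ} :
    L.Edge x y ↔ 0 ≤ x ∧ x ≤ L.size ∧ 0 ≤ y ∧ y ≤ L.size ∧
      (node R b L W).Edge (R.size + L.size + 1 - x) (R.size + L.size + 1 - y) := by
  refine ⟨fun h => ⟨h.range.1, h.range.2.1, h.range.2.2.1, h.range.2.2.2,
    edge_node_mid (by simpa using h)⟩, fun ⟨hx, hx', hy, hy', h⟩ => ?_⟩
  have hn := h.ne
  rcases edge_node h with h | h | h | h | h <;> first | omega | simpa using h.1

theorem edge_right_iff {R L W : Code} (b : Bool) {x y : ℤ} :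
    W.Edge x y ↔ 0 ≤ x ∧ 0 ≤ y ∧
      (node R b L W).Edge (x + (R.size + L.size + 1)) (y + (R.size + L.size + 1)) := by
  refine ⟨fun h => ⟨h.range.1, h.range.2.2.1, edge_node_right (by simpa using h)⟩,
    fun ⟨hx, hy, h⟩ => ?_⟩
  have hn := h.ne
  rcases edge_node h with h | h | h | h | h <;> first | omega | simpa using h.1

theorem bar_node {R L W : Code} {b : Bool} {i : ℤ} (h : (node R b L W).Bar i) :
    (R.Bar i ∧ 0 ≤ i ∧ i < R.size) ∨ (i = R.size ∧ b = true) ∨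
    (L.Bar (R.size + L.size - i) ∧ R.size < i ∧ i ≤ R.size + L.size) ∨
    (W.Bar (i - (R.size + L.size + 1)) ∧ R.size + L.size + 1 ≤ i ∧
      i < R.size + L.size + W.size + 1) := by
  rcases h with h | h | h | h
  · exact Or.inl ⟨h, h.range⟩
  · exact Or.inr (Or.inl h)
  · have := h.range
    exact Or.inr (Or.inr (Or.inl ⟨h, by omega⟩))
  · have := h.range
    exact Or.inr (Or.inr (Or.inr ⟨h, by omega⟩))

theorem bar_left_iff {R L W : Code} (b : Bool) {i : ℤ} :
    R.Bar i ↔ i < R.size ∧ (node R b L W).Bar i := by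
  refine ⟨fun h => ⟨h.range.2, Or.inl h⟩, fun ⟨hx, h⟩ => ?_⟩
  rcases bar_node h with h | h | h | h <;> first | exact h.1 | omega

theorem bar_bit_iff {R L W : Code} {b : Bool} :
    b = true ↔ (node R b L W).Bar R.size := by
  refine ⟨fun h => Or.inr (Or.inl ⟨rfl, h⟩), fun h => ?_⟩
  rcases bar_node h with h | h | h | h <;> first | exact h.2 | omega

theorem bar_mid_iff {R L W : Code} (b : Bool) {i : ℤ} :
    L.Bar i ↔ 0 ≤ i ∧ i < L.size ∧ (node R b L W).Bar (R.size + L.size - i) := by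
  refine ⟨fun h => ⟨h.range.1, h.range.2, Or.inr (Or.inr (Or.inl (by simpa using h)))⟩,
    fun ⟨hx, hx', h⟩ => ?_⟩
  rcases bar_node h with h | h | h | h <;> first | omega | simpa using h.1

theorem bar_right_iff {R L W : Code} (b : Bool) {i : ℤ} :
    W.Bar i ↔ 0 ≤ i ∧ (node R b L W).Bar (i + (R.size + L.size + 1)) := by
  refine ⟨fun h => ⟨h.range.1, Or.inr (Or.inr (Or.inr (by simpa using h)))⟩,
    fun ⟨hx, h⟩ => ?_⟩
  rcases bar_node h with h | h | h | h <;> first | omega | simpa using h.1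

/-- The largest neighbour of 0 determines c, connectivity of the left piece determines the cut m
(`left_size_le`), and the pieces and the bit are then restrictions of the given data. -/
theorem ext_of_edge {k k' : Code} (hs : k.size = k'.size)
    (hE : ∀ x y, k.Edge x y ↔ k'.Edge x y) (hB : ∀ i, k.Bar i ↔ k'.Bar i) : k = k' := by
  induction k generalizing k' with
  | leaf =>
    cases k' with
    | leaf => rfl
    | node => simp [size] at hs
  | node R b L W hR hL hW =>
    cases k' with
    | leaf => simp [size] at hs
    | node R' b' L' W' =>
      have hc : R.size + L.size = R'.size + L'.size := by
        have h1 := edge_node ((hE _ _).1 (edge_node_root (R := R) (L := L) (W := W) (b := b)))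
        have h2 := edge_node ((hE _ _).2 (edge_node_root (R := R') (L := L') (W := W') (b := b')))
        omega
      have hm : R.size = R'.size :=
        le_antisymm (left_size_le hc.symm fun x y => (hE x y).symm) (left_size_le hc hE)
      have hl : L.size = L'.size := by omega
      have hw : W.size = W'.size := by simp only [size] at hs; omega
      have eR : R = R' := hR hm
        (fun x y => by
          rw [edge_left_iff (R := R) (L := L) (W := W) b,
            edge_left_iff (R := R') (L := L') (W := W') b', hE, hm])
        (fun i => by
          rw [bar_left_iff (R := R) (L := L) (W := W) b,
            bar_left_iff (R := R') (L := L') (W := W') b', hB, hm])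
      have eL : L = L' := hL hl
        (fun x y => by
          rw [edge_mid_iff (R := R) (L := L) (W := W) b,
            edge_mid_iff (R := R') (L := L') (W := W') b', hE, hm, hl])
        (fun i => by
          rw [bar_mid_iff (R := R) (L := L) (W := W) b,
            bar_mid_iff (R := R') (L := L') (W := W') b', hB, hm, hl])
      have eW : W = W' := hW hw
        (fun x y => by
          rw [edge_right_iff (R := R) (L := L) (W := W) b,
            edge_right_iff (R := R') (L := L') (W := W') b', hE, hm, hl])
        (fun i => by
          rw [bar_right_iff (R := R) (L := L) (W := W) b,
            bar_right_iff (R := R') (L := L') (W := W') b', hB, hm, hl])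
      have eb : b = b' := by
        rw [Bool.eq_iff_iff, bar_bit_iff (R := R) (L := L) (W := W),
          bar_bit_iff (R := R') (L := L') (W := W'), hB, hm]
      rw [eR, eL, eW, eb]

end Code

end GNC

/-! ### Cutting a noncrossing tree at the last edge of its root -/

namespace GNC

open Relation

/-- The relation `r`, restricted to the interval `[a, b]`. -/
def Within (r : ℤ → ℤ → Prop) (a b x y : ℤ) : Prop :=
  r x y ∧ a ≤ x ∧ x ≤ b ∧ a ≤ y ∧ y ≤ b

/-- Every edge `ac` of `r` is a bridge. -/
def AcyclicRel (r : ℤ → ℤ → Prop) : Prop :=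
  ∀ a c, r a c →
    ¬ ReflTransGen (fun x y => r x y ∧ ¬ (x = a ∧ y = c) ∧ ¬ (x = c ∧ y = a)) a c

/-- No two edges of `r` cross. -/
def NoncrossingRel (r : ℤ → ℤ → Prop) : Prop :=
  ∀ p q s t : ℤ, p < q → q < s → s < t → r p s → r q t → False

theorem AcyclicRel.comp {r : ℤ → ℤ → Prop} (h : AcyclicRel r) {f : ℤ → ℤ}
    (hf : Function.Injective f) : AcyclicRel fun x y => r (f x) (f y) := by
  intro a c hac hr
  refine h _ _ hac (hr.lift f fun x y hxy => ?_)
  simpa only [Function.onFun, hf.eq_iff] using hxy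

/-- The splitting of a connected noncrossing forest on `[0, n]` at the edge from `0` to its last
neighbour `c`. -/
theorem exists_split {n : ℕ} (hn : 0 < n) {r : ℤ → ℤ → Prop} (hs : ∀ x y, r x y → r y x)
    (ha : AcyclicRel r) (hx : NoncrossingRel r)
    (hcon : ∀ x : ℤ, 0 ≤ x → x ≤ n → ReflTransGen (Within r 0 n) 0 x) :
    ∃ m c : ℤ, 0 ≤ m ∧ m < c ∧ c ≤ n ∧ r 0 c ∧
      (∀ x, 0 ≤ x → x ≤ m → ReflTransGen (Within r 0 m) 0 x) ∧
      (∀ x, m + 1 ≤ x → x ≤ c → ReflTransGen (Within r (m + 1) c) c x) ∧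
      (∀ x, c ≤ x → x ≤ n → ReflTransGen (Within r c n) c x) ∧
      ∀ x y, r x y → 0 ≤ x → x < y → y ≤ n →
        y ≤ m ∨ (m + 1 ≤ x ∧ y ≤ c) ∨ c ≤ x ∨ (x = 0 ∧ y = c) := by
  have hirr : ∀ x, ¬ r x x := fun x h => ha x x h ReflTransGen.refl
  obtain ⟨c, ⟨h0c, hcn, hrc⟩, hmax⟩ : ∃ c : ℤ, (0 < c ∧ c ≤ n ∧ r 0 c) ∧
      ∀ y : ℤ, (0 < y ∧ y ≤ n ∧ r 0 y) → y ≤ c := by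
    refine Int.exists_greatest_of_bdd ⟨n, fun z hz => hz.2.1⟩ ?_
    obtain ⟨x, y, -, hxy, h, h'⟩ := exists_step (hcon n (by omega) le_rfl) (fun x => x = 0) rfl
      (by omega)
    subst h
    obtain ⟨h1, h2, h3, h4, h5⟩ := hxy
    exact ⟨y, by omega, h5, h1⟩
  set r' : ℤ → ℤ → Prop := fun x y => Within r 0 n x y ∧ ¬ (x = 0 ∧ y = c) ∧ ¬ (x = c ∧ y = 0)
    with hr'
  have hsymm : ∀ x y, r' x y → r' y x := by
    rintro x y ⟨⟨h, h'⟩, h''⟩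
    exact ⟨⟨hs _ _ h, by omega⟩, by omega⟩
  have hrev : ∀ x y, ReflTransGen r' x y → ReflTransGen r' y x :=
    fun x y h => by
    induction h with
    | refl => exact ReflTransGen.refl
    | tail _ h ih => exact ih.head (hsymm _ _ h)
  -- The edge 0c is a bridge, so the components of 0 and c after its removal are disjoint.
  have hdisj : ∀ x, ReflTransGen r' 0 x → ReflTransGen r' c x → False := by
    intro x h1 h2
    refine ha 0 c hrc (ReflTransGen.mono (fun y z h => ?_) _ _ (h1.trans (hrev _ _ h2)))
    exact ⟨h.1.1, h.2⟩
  have hcov : ∀ x : ℤ, 0 ≤ x → x ≤ n → ReflTransGen r' 0 x ∨ ReflTransGen r' c x := by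
    intro x h0 h1
    have := hcon x h0 h1
    clear h0 h1
    induction this with
    | refl => exact Or.inl ReflTransGen.refl
    | @tail y z _ hyz ih =>
      by_cases h1 : y = 0 ∧ z = c
      · rw [h1.2]; exact Or.inr ReflTransGen.refl
      by_cases h2 : y = c ∧ z = 0
      · rw [h2.2]; exact Or.inl ReflTransGen.refl
      exact ih.imp (fun h => h.tail ⟨hyz, h1, h2⟩) (fun h => h.tail ⟨hyz, h1, h2⟩)
  have hrange : ∀ x, ReflTransGen r' 0 x → 0 ≤ x ∧ x ≤ n := by
    intro x h
    rcases h.cases_tail with h | ⟨y, -, h, -⟩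
    · omega
    · exact h.2.2.2
  -- An edge passing from p < c to beyond c contradicts the maximality of c if p = 0, and crosses 0c
  -- otherwise.
  have hAc : ∀ x, ReflTransGen r' 0 x → x < c := by
    intro x h
    by_contra hxc
    obtain ⟨p, q, hp, hpq, h1, h2⟩ := exists_step h (fun x => x < c) h0c hxc
    have hq := hp.tail hpq
    obtain ⟨⟨h3, h4⟩, h5⟩ := hpq
    have hqc : q ≠ c := fun h => hdisj q hq (h ▸ ReflTransGen.refl)
    by_cases hp0 : p = 0
    · subst hp0
      have := hmax q ⟨by omega, by omega, h3⟩
      omega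
    · exact hx 0 p c q (by omega) (by omega) (by omega) hrc h3
  obtain ⟨m, hm, hmmax⟩ : ∃ m : ℤ, ReflTransGen r' 0 m ∧ ∀ y : ℤ, ReflTransGen r' 0 y → y ≤ m :=
    Int.exists_greatest_of_bdd ⟨c, fun z hz => (hAc z hz).le⟩ ⟨0, ReflTransGen.refl⟩
  have hm0 := hrange m hm
  have hmc := hAc m hm
  -- The component of 0 is an interval: if x < m lay in the component of c, some edge pq of the
  -- first component would pass over x, and the path from x to c > q would have to cross it.
  have hAm : ∀ x, 0 ≤ x → x ≤ m → ReflTransGen r' 0 x := by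
    intro x h0 h1
    refine (hcov x h0 (by omega)).resolve_right fun hC => ?_
    have hx0 : x ≠ 0 := fun h => hdisj x (h ▸ ReflTransGen.refl) hC
    have hxm : x ≠ m := fun h => hdisj x (h ▸ hm) hC
    obtain ⟨p, q, hp, hpq, h2, h3⟩ := exists_step hm (fun y => y < x) (by omega) (by omega)
    have hq := hp.tail hpq
    have hpx : p ≠ x := fun h => hdisj x (h ▸ hp) hC
    have hqx : q ≠ x := fun h => hdisj x (h ▸ hq) hC
    have hqc := hAc q hq
    obtain ⟨s, t, hcs, hst, h4, h5⟩ := exists_step (hrev _ _ hC) (fun y => p < y ∧ y < q)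
      (by omega) (by omega)
    have hCs : ReflTransGen r' c s := hC.trans hcs
    have hCt := hCs.tail hst
    have htp : t ≠ p := fun h => hdisj p hp (h ▸ hCt)
    have htq : t ≠ q := fun h => hdisj q hq (h ▸ hCt)
    rcases lt_or_gt_of_ne htp with h | h
    · exact hx t p s q h h4.1 h4.2 (hs _ _ hst.1.1) hpq.1.1
    · exact hx p s q t h4.1 h4.2 (by omega) hpq.1.1 hst.1.1
  have hCm : ∀ x, m + 1 ≤ x → x ≤ n → ReflTransGen r' c x := fun x h0 h1 =>
    (hcov x (by omega) h1).resolve_left fun h => by have := hmmax x h; omega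
  have hedge : ∀ x y, r x y → 0 ≤ x → x < y → y ≤ n →
      y ≤ m ∨ (m + 1 ≤ x ∧ y ≤ c) ∨ c ≤ x ∨ (x = 0 ∧ y = c) := by
    intro x y hxy h0 h1 h2
    by_contra! hcontra
    obtain ⟨g1, g2, g3, g4⟩ := hcontra
    by_cases hxm : x ≤ m
    · exact hdisj y ((hAm x h0 hxm).tail ⟨⟨hxy, by omega⟩, by omega⟩) (hCm y (by omega) h2)
    · exact hx 0 x c y (by omega) g3 (g2 (by omega)) hrc hxy
  refine ⟨m, c, hm0.1, hmc, hcn, hrc, fun x h0 h1 => ?_, ?_, ?_, hedge⟩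
  · have := hAm x h0 h1
    clear h0 h1
    induction this with
    | refl => exact ReflTransGen.refl
    | @tail y z hy hyz ih =>
      have h1 := hrange y hy
      have h2 := hmmax y hy
      have hz := hy.tail hyz
      have h3 := hrange z hz
      have h4 := hmmax z hz
      exact ih.tail ⟨hyz.1.1, by omega⟩
  all_goals
    -- Both halves are proved together: a path from c can change sides only by passing through c,
    -- where the chain for the other half restarts.
    suffices H : ∀ x, ReflTransGen r' c x →
        (x ≤ c → ReflTransGen (Within r (m + 1) c) c x) ∧
        (c ≤ x → ReflTransGen (Within r c n) c x) by
      intro x h0 h1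
      have := H x (hCm x (by omega) (by omega))
      first | exact this.1 (by omega) | exact this.2 (by omega)
    intro x h
    induction h with
    | refl => exact ⟨fun _ => ReflTransGen.refl, fun _ => ReflTransGen.refl⟩
    | @tail y z hy hyz ih =>
      have hz := hy.tail hyz
      have hym : m < y := by
        by_contra h
        exact hdisj y (hAm y hyz.1.2.1 (by omega)) hy
      have hzm : m < z := by
        by_contra h
        exact hdisj z (hAm z hyz.1.2.2.2.1 (by omega)) hz
      obtain ⟨⟨h1, h2⟩, h3⟩ := hyz
      have hyz' : (y ≤ c ∧ z ≤ c) ∨ (c ≤ y ∧ c ≤ z) := by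
        rcases lt_trichotomy y z with h | h | h
        · have := hedge y z h1 (by omega) h (by omega); omega
        · exact absurd (h ▸ h1) (hirr z)
        · have := hedge z y (hs _ _ h1) (by omega) h (by omega); omega
      rcases hyz' with h | h
      · have := (ih.1 h.1).tail (show Within r (m + 1) c y z from ⟨h1, by omega⟩)
        refine ⟨fun _ => this, fun h' => ?_⟩
        have : z = c := by omega
        rw [this]
      · have := (ih.2 h.1).tail (show Within r c n y z from ⟨h1, by omega⟩)
        refine ⟨fun h' => ?_, fun _ => this⟩
        have : z = c := by omega
        rw [this]

/-- Strong induction along `exists_split`. Keeping `r` and `B` on all of ℤ lets the pieces be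
obtained by mere translation or reflection of the variables. -/
theorem exists_code (n : ℕ) : ∀ (r : ℤ → ℤ → Prop) (B : ℤ → Prop), (∀ x y, r x y → r y x) →
    AcyclicRel r → NoncrossingRel r →
    (∀ x : ℤ, 0 ≤ x → x ≤ n → ReflTransGen (Within r 0 n) 0 x) →
    ∃ k : Code, k.size = n ∧
      (∀ x y : ℤ, 0 ≤ x → x ≤ n → 0 ≤ y → y ≤ n → (r x y ↔ k.Edge x y)) ∧
      ∀ i : ℤ, 0 ≤ i → i < n → (B i ↔ k.Bar i) := by
  induction n using Nat.strong_induction_on with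
  | _ n ih =>
    intro r B hs ha hx hcon
    have hirr : ∀ x, ¬ r x x := fun x h => ha x x h ReflTransGen.refl
    rcases Nat.eq_zero_or_pos n with rfl | hn
    · refine ⟨Code.leaf, rfl, fun x y h1 h2 h3 h4 => ?_, fun i h1 h2 => by omega⟩
      have h5 : x = 0 := by omega
      have h6 : y = 0 := by omega
      subst h5 h6
      exact ⟨fun h => (hirr _ h).elim, fun h => h.elim False.elim False.elim⟩
    obtain ⟨m, c, h0m, hmc, hcn, hrc, hR, hL, hW, hsplit⟩ := exists_split hn hs ha hx hcon
    obtain ⟨p, rfl⟩ := Int.eq_ofNat_of_zero_le h0m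
    obtain ⟨q, hq⟩ := Int.eq_ofNat_of_zero_le (show 0 ≤ c - p - 1 by omega)
    obtain ⟨s, hs'⟩ := Int.eq_ofNat_of_zero_le (show 0 ≤ n - c by omega)
    have hc : c = p + q + 1 := by omega
    clear hq
    subst hc
    obtain ⟨R, hR1, hR2, hR3⟩ := ih p (by omega) r B hs ha hx hR
    obtain ⟨L, hL1, hL2, hL3⟩ := ih q (by omega)
      (fun x y => r (p + q + 1 - x) (p + q + 1 - y)) (fun i => B (p + q - i))
      (fun x y h => hs _ _ h) (ha.comp fun x y h => by simpa using h)
      (fun a b c d h1 h2 h3 h4 h5 => hx (p + q + 1 - d) (p + q + 1 - c) (p + q + 1 - b)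
        (p + q + 1 - a) (by omega) (by omega) (by omega) (hs _ _ h5) (hs _ _ h4))
      (fun x h1 h2 => by
        have := (hL (p + q + 1 - x) (by omega) (by omega)).lift
          (p := Within (fun x y => r (p + q + 1 - x) (p + q + 1 - y)) 0 q)
          (fun y => p + q + 1 - y)
          fun y z h => ⟨by simpa using h.1, by have := h.2; dsimp only; omega⟩
        simpa [Function.onFun] using this)
    obtain ⟨W, hW1, hW2, hW3⟩ := ih s (by omega)
      (fun x y => r (x + (p + q + 1)) (y + (p + q + 1))) (fun i => B (i + (p + q + 1)))
      (fun x y h => hs _ _ h) (ha.comp fun x y h => by simpa using h)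
      (fun a b c d h1 h2 h3 h4 h5 => hx _ _ _ _ (by omega) (by omega) (by omega) h4 h5)
      (fun x h1 h2 => by
        have := (hW (x + (p + q + 1)) (by omega) (by omega)).lift
          (p := Within (fun x y => r (x + (p + q + 1)) (y + (p + q + 1))) 0 s)
          (fun y => y - (p + q + 1))
          fun y z h => ⟨by simpa using h.1, by have := h.2; dsimp only; omega⟩
        simpa [Function.onFun] using this)
    subst hR1 hL1 hW1
    classical
    refine ⟨Code.node R (decide (B R.size)) L W, by simp only [Code.size]; omega,
      fun x y hx0 hxn hy0 hyn => ⟨fun h => ?_, fun h => ?_⟩,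
      fun i hi0 hin => ⟨fun h => ?_, fun h => ?_⟩⟩
    · have hxy : x ≠ y := fun e => hirr y (e ▸ h)
      have : (x ≤ R.size ∧ y ≤ R.size) ∨ (R.size + 1 ≤ x ∧ R.size + 1 ≤ y ∧
          x ≤ R.size + L.size + 1 ∧ y ≤ R.size + L.size + 1) ∨
          (R.size + L.size + 1 ≤ x ∧ R.size + L.size + 1 ≤ y) ∨
          (x = 0 ∧ y = R.size + L.size + 1) ∨ (y = 0 ∧ x = R.size + L.size + 1) := by
        rcases lt_or_gt_of_ne hxy with h' | h'
        · have := hsplit x y h hx0 h' hyn; omega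
        · have := hsplit y x (hs _ _ h) hy0 h' hxn; omega
      rcases this with h' | h' | h' | ⟨rfl, rfl⟩ | ⟨rfl, rfl⟩
      · exact Code.edge_node_left ((hR2 x y hx0 h'.1 hy0 h'.2).1 h)
      · exact Code.edge_node_mid ((hL2 _ _ (by omega) (by omega) (by omega) (by omega)).1
          (by simpa using h))
      · exact Code.edge_node_right ((hW2 _ _ (by omega) (by omega) (by omega) (by omega)).1
          (by simpa using h))
      · exact Code.edge_node_root
      · exact Code.edge_node_root.symm
    · rcases Code.edge_node h with ⟨h, h'⟩ | ⟨rfl, rfl⟩ | ⟨rfl, rfl⟩ | ⟨h, h'⟩ | ⟨h, h'⟩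
      · exact (hR2 x y hx0 (by omega) hy0 (by omega)).2 h
      · exact hrc
      · exact hs _ _ hrc
      · simpa using (hL2 _ _ (by omega) (by omega) (by omega) (by omega)).2 h
      · simpa using (hW2 _ _ (by omega) (by omega) (by omega) (by omega)).2 h
    · rcases lt_trichotomy i R.size with h' | rfl | h'
      · exact Or.inl ((hR3 i hi0 h').1 h)
      · exact Or.inr (Or.inl ⟨rfl, by simpa using h⟩)
      · by_cases h'' : i ≤ R.size + L.size
        · exact Or.inr (Or.inr (Or.inl ((hL3 _ (by omega) (by omega)).1 (by simpa using h))))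
        · exact Or.inr (Or.inr (Or.inr ((hW3 _ (by omega) (by omega)).1 (by simpa using h))))
    · rcases Code.bar_node h with ⟨h, h'⟩ | ⟨rfl, hb⟩ | ⟨h, h'⟩ | ⟨h, h'⟩
      · exact (hR3 i hi0 (by omega)).2 h
      · simpa using hb
      · simpa using (hL3 _ (by omega) (by omega)).2 h
      · simpa using (hW3 _ (by omega) (by omega)).2 h

end GNC

/-! ### Good codes and the functional equation -/

namespace GNC

namespace Code

/-- The label jumps somewhere between `x` and `y`, and `x < y`. -/
def Jump (k : Code) (x y : ℤ) : Prop := ∃ g, x ≤ g ∧ g < y ∧ k.Bar g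

/-- All labels are equal. -/
def Flat (k : Code) : Prop := ∀ g, ¬ k.Bar g

/-- No ascent starts at the root. -/
def RootFlat (k : Code) : Prop := ∀ y, k.Arc 0 y → ¬ k.Jump 0 y

/-- No two consecutive edges are both ascents or both descents. -/
def Good (k : Code) : Prop := ∀ x y z, k.Arc x y → k.Arc y z →
  ¬ (k.Jump x y ∧ k.Jump y z) ∧ ¬ (k.Jump y x ∧ k.Jump z y)

theorem Flat.not_jump {k : Code} (h : k.Flat) {x y : ℤ} : ¬ k.Jump x y :=
  fun ⟨g, _, _, hg⟩ => h g hg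

theorem Flat.good {k : Code} (h : k.Flat) : k.Good :=
  fun _ _ _ _ _ => ⟨fun h' => h.not_jump h'.1, fun h' => h.not_jump h'.1⟩

theorem Flat.rootFlat {k : Code} (h : k.Flat) : k.RootFlat := fun _ _ => h.not_jump

theorem flat_leaf : leaf.Flat := fun _ => id

theorem jump_left_iff {R L W : Code} (b : Bool) {x y : ℤ} (hy : y ≤ R.size) :
    R.Jump x y ↔ (node R b L W).Jump x y := by
  refine exists_congr fun g => and_congr_right fun _ => and_congr_right fun _ => ?_
  rw [bar_left_iff (L := L) (W := W) b]
  exact and_iff_right (by omega)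

theorem jump_mid_iff {R L W : Code} (b : Bool) {x y : ℤ} (hx : 0 ≤ x) (hy : y ≤ L.size) :
    L.Jump x y ↔
      (node R b L W).Jump (R.size + L.size + 1 - y) (R.size + L.size + 1 - x) := by
  constructor
  · rintro ⟨g, h1, h2, h3⟩
    exact ⟨_, by omega, by omega, ((bar_mid_iff (R := R) (W := W) b).1 h3).2.2⟩
  · rintro ⟨g, h1, h2, h3⟩
    exact ⟨R.size + L.size - g, by omega, by omega,
      (bar_mid_iff (R := R) (W := W) b).2 ⟨by omega, by omega, by simpa using h3⟩⟩

theorem jump_right_iff {R L W : Code} (b : Bool) {x y : ℤ} (hx : 0 ≤ x) :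
    W.Jump x y ↔
      (node R b L W).Jump (x + (R.size + L.size + 1)) (y + (R.size + L.size + 1)) := by
  constructor
  · rintro ⟨g, h1, h2, h3⟩
    exact ⟨_, by omega, by omega, ((bar_right_iff (R := R) (L := L) b).1 h3).2⟩
  · rintro ⟨g, h1, h2, h3⟩
    exact ⟨g - (R.size + L.size + 1), by omega, by omega,
      (bar_right_iff (R := R) (L := L) b).2 ⟨by omega, by simpa using h3⟩⟩

/-- The edge from 0 to c spans exactly the gaps of `R`, the gap of the bit and the gaps of `L`. -/
theorem jump_root_iff {R L W : Code} {b : Bool} :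
    ¬ (node R b L W).Jump 0 (R.size + L.size + 1) ↔ R.Flat ∧ b = false ∧ L.Flat := by
  refine ⟨fun h => ⟨fun g hg => ?_, ?_, fun g hg => ?_⟩, fun ⟨h1, h2, h3⟩ ⟨g, g1, g2, hg⟩ => ?_⟩
  · have := hg.range
    exact h ⟨g, by omega, by omega, Or.inl hg⟩
  · exact Bool.eq_false_iff.2 fun hb => h ⟨R.size, by omega, by omega, bar_bit_iff.1 hb⟩
  · have := hg.range
    exact h ⟨_, by omega, by omega, ((bar_mid_iff b).1 hg).2.2⟩
  · rcases bar_node hg with hg | hg | hg | hg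
    · exact h1 _ hg.1
    · simp [h2] at hg
    · exact h3 _ hg.1
    · omega

theorem rootFlat_leaf : leaf.RootFlat := flat_leaf.rootFlat

/-- The last child is the farthest, so if the edge to it is not an ascent, no edge from the root is.
-/
theorem rootFlat_node {R L W : Code} {b : Bool} :
    (node R b L W).RootFlat ↔ R.Flat ∧ b = false ∧ L.Flat := by
  rw [← jump_root_iff (W := W)]
  refine ⟨fun h => h _ (Or.inr (Or.inl ⟨rfl, rfl⟩)), fun h y hy => fun ⟨g, g1, g2, hg⟩ => ?_⟩
  refine h ⟨g, g1, ?_, hg⟩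
  rcases arc_node hy with hy | hy | hy | hy <;> omega

theorem good_leaf : leaf.Good := flat_leaf.good

/-- Two consecutive edges lie in one piece, or the first is 0 → c. Reflection swaps the two clauses
of `Good` for `L`. After an ascent 0 → c, only a further ascent into `W` is forbidden. -/
theorem good_node {R L W : Code} {b : Bool} :
    (node R b L W).Good ↔
      R.Good ∧ L.Good ∧ W.Good ∧ ((R.Flat ∧ b = false ∧ L.Flat) ∨ W.RootFlat) := by
  rw [← jump_root_iff (W := W)]
  constructor
  · intro h
    refine ⟨fun x y z hxy hyz => ?_, fun x y z hxy hyz => ?_, fun x y z hxy hyz => ?_, ?_⟩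
    · have h1 := hxy.range
      have h2 := hyz.range
      rw [jump_left_iff (L := L) (W := W) b (x := x) (by omega),
        jump_left_iff (L := L) (W := W) b (x := y) (y := z) (by omega),
        jump_left_iff (L := L) (W := W) b (x := y) (y := x) (by omega),
        jump_left_iff (L := L) (W := W) b (x := z) (by omega)]
      exact h x y z (Or.inl hxy) (Or.inl hyz)
    · have h1 := hxy.range
      have h2 := hyz.range
      rw [jump_mid_iff (R := R) (W := W) b (x := x) (by omega) (by omega),
        jump_mid_iff (R := R) (W := W) b (x := y) (y := z) (by omega) (by omega),
        jump_mid_iff (R := R) (W := W) b (x := y) (y := x) (by omega) (by omega),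
        jump_mid_iff (R := R) (W := W) b (x := z) (by omega) (by omega)]
      exact (h _ _ _ (Or.inr (Or.inr (Or.inl (by simpa using hxy))))
        (Or.inr (Or.inr (Or.inl (by simpa using hyz))))).symm
    · have h1 := hxy.range
      have h2 := hyz.range
      rw [jump_right_iff (R := R) (L := L) b (x := x) (by omega),
        jump_right_iff (R := R) (L := L) b (x := y) (y := z) (by omega),
        jump_right_iff (R := R) (L := L) b (x := y) (y := x) (by omega),
        jump_right_iff (R := R) (L := L) b (x := z) (by omega)]
      exact h _ _ _ (Or.inr (Or.inr (Or.inr (by simpa using hxy))))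
        (Or.inr (Or.inr (Or.inr (by simpa using hyz))))
    · refine or_iff_not_imp_left.2 fun h0 y hy hj => ?_
      rw [not_not] at h0
      rw [jump_right_iff (R := R) (L := L) b le_rfl, zero_add] at hj
      exact (h 0 _ _ (Or.inr (Or.inl ⟨rfl, rfl⟩))
        (Or.inr (Or.inr (Or.inr (by simpa using hy))))).1 ⟨h0, hj⟩
  · rintro ⟨hR, hL, hW, h0⟩ x y z hxy hyz
    rcases arc_node hxy with ⟨h1, _⟩ | h1 | ⟨h1, _⟩ | ⟨h1, _⟩ <;>
      rcases arc_node hyz with ⟨h2, _⟩ | h2 | ⟨h2, _⟩ | ⟨h2, _⟩ <;> try omega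
    · have := hR x y z h1 h2
      rwa [jump_left_iff (L := L) (W := W) b (x := x) (by omega),
        jump_left_iff (L := L) (W := W) b (x := y) (y := z) (by omega),
        jump_left_iff (L := L) (W := W) b (x := y) (y := x) (by omega),
        jump_left_iff (L := L) (W := W) b (x := z) (by omega)] at this
    -- From 0 right to c, then back left into `L`: the edges point in opposite directions, so
    -- neither clause can be violated.
    · refine ⟨fun ⟨_, g, h3, h4, _⟩ => by omega, fun ⟨⟨g, h3, h4, _⟩, _⟩ => by omega⟩
    · obtain ⟨rfl, rfl⟩ := h1
      refine ⟨fun ⟨h3, h4⟩ => ?_, fun ⟨⟨g, h3, h4, _⟩, _⟩ => by omega⟩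
      refine h0.elim (fun h => h h3) fun h => h (z - (R.size + L.size + 1)) (by simpa using h2) ?_
      rw [jump_right_iff (R := R) (L := L) b le_rfl]
      simpa using h4
    · have := hL _ _ _ h1 h2
      iterate 4 rw [jump_mid_iff (R := R) (L := L) (W := W) b (by omega) (by omega)] at this
      simpa using this.symm
    · have := hW _ _ _ h1 h2
      iterate 4 rw [jump_right_iff (R := R) (L := L) (W := W) b (by omega)] at this
      simpa using this

theorem finite_size_le (n : ℕ) : {k : Code | k.size ≤ n}.Finite := by
  induction n with
  | zero =>
    refine (Set.finite_singleton leaf).subset fun k hk => ?_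
    cases k with
    | leaf => rfl
    | node => simp [size] at hk
  | succ n ih =>
    refine ((Set.finite_singleton leaf).union
      (((ih.prod (Set.toFinite (Set.univ : Set Bool))).prod (ih.prod ih)).image
        fun x => node x.1.1 x.1.2 x.2.1 x.2.2)).subset fun k hk => ?_
    cases k with
    | leaf => exact Or.inl rfl
    | node R b L W =>
      simp only [Set.mem_ofPred_eq, size] at hk
      refine Or.inr ⟨((R, b), (L, W)), ?_, rfl⟩
      simp
      omega

/-- The codes of size `n`. -/
noncomputable def ofSize (n : ℕ) : Finset Code :=
  ((finite_size_le n).subset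
    (show {k : Code | k.size = n} ⊆ _ from fun k (h : k.size = n) => h.le)).toFinset

@[simp]
theorem mem_ofSize {n : ℕ} {k : Code} : k ∈ ofSize n ↔ k.size = n := by
  simp [ofSize]

/-- The generating function of a weight on codes. -/
noncomputable def gf (f : Code → ℤ) : PowerSeries ℤ :=
  PowerSeries.mk fun n => ∑ k ∈ ofSize n, f k

/-- The nested antidiagonals follow the bracketing of `gf f * gf h * gf w`, to match `coeff_gf_mul`.
-/
theorem sum_ofSize_succ (n : ℕ) (F : Code → ℤ) :
    ∑ k ∈ ofSize (n + 1), F k =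
      ∑ p ∈ Finset.HasAntidiagonal.antidiagonal n, ∑ q ∈ Finset.HasAntidiagonal.antidiagonal p.1,
      ∑ R ∈ ofSize q.1, ∑ L ∈ ofSize q.2, ∑ W ∈ ofSize p.2,
        (F (node R true L W) + F (node R false L W)) := by
  have hb : ∀ R L W, F (node R true L W) + F (node R false L W) =
      ∑ b : Bool, F (node R b L W) := fun R L W => by simp
  simp only [hb, Finset.sum_sigma']
  symm
  refine Finset.sum_bij (fun x _ => node x.2.2.1 x.2.2.2.2.2 x.2.2.2.1 x.2.2.2.2.1) ?_ ?_ ?_ ?_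
  · rintro ⟨⟨p, p'⟩, ⟨q, q'⟩, R, L, W, b⟩ h
    simp only [Finset.mem_sigma, Finset.HasAntidiagonal.mem_antidiagonal, mem_ofSize] at h
    simp only [mem_ofSize, size]
    omega
  · rintro ⟨⟨p, p'⟩, ⟨q, q'⟩, R, L, W, b⟩ h ⟨⟨s, s'⟩, ⟨t, t'⟩, R', L', W', b'⟩ h' e
    simp only [Finset.mem_sigma, Finset.HasAntidiagonal.mem_antidiagonal, mem_ofSize] at h h'
    simp only [node.injEq] at e
    obtain ⟨rfl, rfl, rfl, rfl⟩ := e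
    obtain ⟨h1, h2, h3, h4, h5, -⟩ := h
    obtain ⟨h1', h2', h3', h4', h5', -⟩ := h'
    subst h3 h4 h5 h3' h4' h5' h2 h2'
    rfl
  · intro k hk
    cases k with
    | leaf => simp [size] at hk
    | node R b L W =>
      refine ⟨⟨(R.size + L.size, W.size), (R.size, L.size), R, L, W, b⟩, ?_, rfl⟩
      simp only [mem_ofSize, size] at hk
      simp
      omega
  · intros; rfl

theorem coeff_gf_mul (n : ℕ) (f h w : Code → ℤ) :
    PowerSeries.coeff n (gf f * gf h * gf w) =
      ∑ p ∈ Finset.HasAntidiagonal.antidiagonal n, ∑ q ∈ Finset.HasAntidiagonal.antidiagonal p.1,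
        ∑ R ∈ ofSize q.1, ∑ L ∈ ofSize q.2, ∑ W ∈ ofSize p.2, f R * h L * w W := by
  simp only [PowerSeries.coeff_mul, gf, PowerSeries.coeff_mk]
  refine Finset.sum_congr rfl fun p _ => ?_
  rw [Finset.sum_mul]
  refine Finset.sum_congr rfl fun q _ => ?_
  rw [Finset.sum_mul_sum, Finset.sum_mul]
  refine Finset.sum_congr rfl fun R _ => ?_
  rw [Finset.sum_mul]
  refine Finset.sum_congr rfl fun L _ => ?_
  rw [Finset.mul_sum]

/-- A weight that, summed over the bit, splits into products over the three pieces satisfies an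
algebraic equation. Two products are needed for `T`; for `S` the second is taken to be zero. -/
theorem gf_eq {F f h w f' h' w' : Code → ℤ} (h0 : F leaf = 1)
    (hF : ∀ R L W, F (node R true L W) + F (node R false L W) =
      f R * h L * w W + f' R * h' L * w' W) :
    gf F = 1 + PowerSeries.X * (gf f * gf h * gf w + gf f' * gf h' * gf w') := by
  ext n
  cases n with
  | zero =>
    have : ofSize 0 = {leaf} := by
      ext k
      cases k <;> simp [size]
    simp [gf, this, h0]
  | succ n =>
    rw [map_add, PowerSeries.coeff_succ_X_mul, map_add, coeff_gf_mul, coeff_gf_mul, gf,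
      PowerSeries.coeff_mk, sum_ofSize_succ]
    simp only [hF, Finset.sum_add_distrib, PowerSeries.coeff_one, Nat.succ_ne_zero, if_false,
      zero_add]

theorem gf_sub (f g : Code → ℤ) : gf (fun k => f k - g k) = gf f - gf g := by
  ext n; simp [gf]

theorem gf_two_mul (f : Code → ℤ) : gf (fun k => 2 * f k) = 2 * gf f := by
  ext n; simp [gf, two_mul, Finset.sum_add_distrib]

theorem gf_zero : gf (fun _ => 0) = 0 := by
  ext n; simp [gf]

open Classical in
/-- The functional equation for the generating function of good codes. -/
theorem gf_good :
    gf (fun k => if k.Good then 1 else 0) =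
      (1 + PowerSeries.X * gf (fun k => if k.Flat then 1 else 0) ^ 2 *
        gf (fun k => if k.Good then 1 else 0)) *
      (1 - PowerSeries.X * gf (fun k => if k.Flat then 1 else 0) ^ 2 +
        2 * PowerSeries.X * gf (fun k => if k.Good then 1 else 0) ^ 2) := by
  set N : Code → ℤ := fun k => if k.Flat then 1 else 0 with hN
  set T : Code → ℤ := fun k => if k.Good then 1 else 0 with hT
  set S : Code → ℤ := fun k => if k.Good ∧ k.RootFlat then 1 else 0 with hS
  have hST : gf S = 1 + PowerSeries.X * (gf N * gf N * gf T +
      gf (fun _ => 0) * gf (fun _ => 0) * gf (fun _ => 0)) := by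
    refine gf_eq (by simp [hS, good_leaf, rootFlat_leaf]) fun R L W => ?_
    simp only [hS, hN, hT, good_node, rootFlat_node]
    have hR : R.Flat → R.Good := Flat.good
    have hL : L.Flat → L.Good := Flat.good
    by_cases h1 : R.Flat <;> by_cases h2 : L.Flat <;> by_cases h3 : W.Good <;>
      simp [h1, h2, h3, hR, hL]
  -- If `W` has no ascent at its root, the bit and the good pieces `R`, `L` are free, whence the
  -- factor 2. Otherwise `R` and `L` are flat and the bit is `false`.
  have hTT : gf T = 1 + PowerSeries.X * (gf (fun k => 2 * T k) * gf T * gf S +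
      gf N * gf N * gf (fun k => T k - S k)) := by
    refine gf_eq (by simp [hT, good_leaf]) fun R L W => ?_
    simp only [hS, hN, hT, good_node]
    have hR : R.Flat → R.Good := Flat.good
    have hL : L.Flat → L.Good := Flat.good
    by_cases h1 : R.Flat <;> by_cases h2 : L.Flat <;> by_cases h3 : W.Good <;>
      by_cases h4 : W.RootFlat <;> by_cases h5 : R.Good <;> by_cases h6 : L.Good <;>
      simp_all
  rw [gf_zero] at hST
  rw [gf_two_mul, gf_sub] at hTT
  have h1 : 1 + PowerSeries.X * gf N ^ 2 * gf T = gf S := by rw [hST]; ring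
  rw [h1]
  linear_combination hTT + h1

end Code

end GNC

/-! ### The bijection between codes and GNC-trees -/

namespace GNC

open Relation

open Classical in
/-- The labels, starting from `1`, that jump after the vertices in `B`. -/
noncomputable def labelOf (B : ℤ → Prop) : ℕ → ℕ
  | 0 => 1
  | i + 1 => labelOf B i + if B i then 1 else 0

theorem labelOf_mono (B : ℤ → Prop) : Monotone (labelOf B) :=
  monotone_nat_of_le_succ fun i => by simp [labelOf]

theorem labelOf_lt_succ_iff {B : ℤ → Prop} {i : ℕ} : labelOf B i < labelOf B (i + 1) ↔ B i := by
  simp only [labelOf]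
  split_ifs with h <;> simp [h]

theorem labelOf_closed (B : ℤ → Prop) (m i : ℕ) (h1 : 1 ≤ i) (h2 : i ≤ labelOf B m) :
    ∃ j ≤ m, labelOf B j = i := by
  induction m with
  | zero => exact ⟨0, le_rfl, le_antisymm h1 h2⟩
  | succ m ih =>
    by_cases h : i ≤ labelOf B m
    · obtain ⟨j, hj, hj'⟩ := ih h
      exact ⟨j, by omega, hj'⟩
    · refine ⟨m + 1, le_rfl, ?_⟩
      simp only [labelOf] at h2 ⊢
      split_ifs at h2 ⊢ <;> omega

theorem labelOf_lt_iff {k : Code} {i j : ℕ} :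
    labelOf k.Bar i < labelOf k.Bar j ↔ k.Jump i j := by
  constructor
  · intro h
    by_contra hJ
    by_cases hij : i ≤ j
    · have : ∀ m, i ≤ m → m ≤ j → labelOf k.Bar m = labelOf k.Bar i := by
        intro m hm
        induction m, hm using Nat.le_induction with
        | base => exact fun _ => rfl
        | succ m hm ih =>
          intro hj
          have h1 : ¬ k.Bar m := fun hb => hJ ⟨m, by omega, by omega, hb⟩
          simp only [labelOf, h1, if_false, add_zero]
          exact ih (by omega)
      exact h.ne' (this j hij le_rfl)
    · exact absurd (labelOf_mono k.Bar (by omega : j ≤ i)) (by omega)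
  · rintro ⟨g, h1, h2, hg⟩
    obtain ⟨g, rfl⟩ := Int.eq_ofNat_of_zero_le hg.range.1
    calc labelOf k.Bar i ≤ labelOf k.Bar g := labelOf_mono _ (by omega)
      _ < labelOf k.Bar (g + 1) := labelOf_lt_succ_iff.2 hg
      _ ≤ labelOf k.Bar j := labelOf_mono _ (by omega)

namespace Code

/-- The graph encoded by `k`. -/
def graph (k : Code) (n : ℕ) : SimpleGraph (Fin (n + 1)) where
  Adj i j := k.Edge (i : ℕ) (j : ℕ)
  symm := ⟨fun _ _ h => h.symm⟩
  loopless := ⟨fun _ h => h.ne rfl⟩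

theorem reachable {k : Code} {n : ℕ} (hk : k.size = n) (j : Fin (n + 1)) :
    (k.graph n).Reachable 0 j := by
  suffices ∀ x, ReflTransGen k.Arc 0 x → ∀ j : Fin (n + 1), ((j : ℕ) : ℤ) = x →
      (k.graph n).Reachable 0 j from
    this _ (k.reach (by omega) (by have := j.2; omega)) j rfl
  intro x hx
  induction hx with
  | refl =>
    intro j hj
    have : j = 0 := Fin.ext (by simpa using hj)
    rw [this]
  | @tail y z _ hyz ih =>
    intro j hj
    have hr := hyz.range
    have hy : (((⟨y.toNat, by omega⟩ : Fin (n + 1)) : ℕ) : ℤ) = y := by simp; omega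
    refine (ih _ hy).trans (SimpleGraph.Adj.reachable ?_)
    exact Or.inl (by rw [hy, hj]; exact hyz)

/-- Every nonroot vertex has exactly one parent, so a connected graph on n + 1 vertices is left with
at most n edges. -/
theorem graph_isTree {k : Code} {n : ℕ} (hk : k.size = n) : (k.graph n).IsTree := by
  have hcon : (k.graph n).Connected :=
    (SimpleGraph.connected_iff _).2
      ⟨fun i j => (reachable hk i).symm.trans (reachable hk j), ⟨0⟩⟩
  refine SimpleGraph.isTree_iff_connected_and_card.2 ⟨hcon, ?_⟩
  have h1 := hcon.card_vert_le_card_edgeSet_add_one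
  refine le_antisymm ?_ h1
  have hpar : ∀ j : Fin n, ∃ i : Fin (n + 1), k.Arc (i : ℕ) ((j : ℕ) + 1) := by
    intro j
    rcases (k.reach (x := (j : ℕ) + 1) (by omega) (by omega)).cases_tail with h | ⟨y, -, h⟩
    · omega
    · have hr := h.range
      refine ⟨⟨y.toNat, by omega⟩, ?_⟩
      have : ((y.toNat : ℕ) : ℤ) = y := by omega
      simpa only [this] using h
  choose f hf using hpar
  have hsub : (k.graph n).edgeSet ⊆ Set.range fun j : Fin n => s(f j, j.succ) := by
    intro e
    induction e using Sym2.ind with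
    | _ a b =>
      have key : ∀ a b : Fin (n + 1), k.Arc (a : ℕ) (b : ℕ) →
          s(a, b) ∈ Set.range fun j : Fin n => s(f j, j.succ) := by
        intro a b h
        have hr := h.range
        have hb : b ≠ 0 := by rintro rfl; simp at hr
        obtain ⟨j, rfl⟩ := Fin.exists_succ_eq.2 hb
        refine ⟨j, ?_⟩
        have := (hf j).parent_unique (by simpa using h)
        have : f j = a := Fin.ext (by exact_mod_cast this)
        simp only [this]
      intro h
      rcases (SimpleGraph.mem_edgeSet _).1 h with h | h
      · exact key a b h
      · rw [Sym2.eq_swap]; exact key b a h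
  have h2 : Nat.card (k.graph n).edgeSet ≤ n := by
    rw [Nat.card_coe_set_eq]
    refine (Set.ncard_le_ncard hsub (Set.finite_range _)).trans ?_
    rw [← Set.image_univ]
    refine (Set.ncard_image_le Set.finite_univ).trans ?_
    simp [Set.ncard_univ]
  simpa using h2

/-- The generalized non-crossing tree encoded by `k`. -/
noncomputable def toTree {n : ℕ} (k : {k : Code // k.size = n}) : Tree n where
  graph := k.1.graph n
  label i := labelOf k.1.Bar i
  isTree := graph_isTree k.2
  noncrossing _ _ _ _ hab hbc hce := fun ⟨h, h'⟩ =>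
    Code.noncrossing (by exact_mod_cast hab) (by exact_mod_cast hbc) (by exact_mod_cast hce) h h'
  label_mono _ _ h := labelOf_mono _ h
  label_pos _ := labelOf_mono k.1.Bar (Nat.zero_le _)
  label_closed v i h1 h2 := by
    obtain ⟨j, hj, hj'⟩ := labelOf_closed k.1.Bar v i h1 h2
    exact ⟨⟨j, by omega⟩, hj'⟩

theorem toTree_injective (n : ℕ) : Function.Injective (toTree (n := n)) := by
  intro k k' h
  have hg : k.1.graph n = k'.1.graph n := congrArg Tree.graph h
  have hl : ∀ i : Fin (n + 1), labelOf k.1.Bar i = labelOf k'.1.Bar i :=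
    congrFun (congrArg Tree.label h)
  have hE : ∀ k k' : {k : Code // k.size = n}, k.1.graph n = k'.1.graph n →
      ∀ x y, k.1.Edge x y → k'.1.Edge x y := by
    intro k k' hg x y h
    have hr := h.range
    rw [k.2] at hr
    have hx : ((x.toNat : ℕ) : ℤ) = x := by omega
    have hy : ((y.toNat : ℕ) : ℤ) = y := by omega
    have : (k'.1.graph n).Adj ⟨x.toNat, by omega⟩ ⟨y.toNat, by omega⟩ := by
      rw [← hg]
      show k.1.Edge (x.toNat : ℕ) (y.toNat : ℕ)
      rwa [hx, hy]
    have : k'.1.Edge (x.toNat : ℕ) (y.toNat : ℕ) := this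
    rwa [hx, hy] at this
  have hB : ∀ k k' : {k : Code // k.size = n},
      (∀ i : Fin (n + 1), labelOf k.1.Bar i = labelOf k'.1.Bar i) →
      ∀ i, k.1.Bar i → k'.1.Bar i := by
    intro k k' hl i h
    have hr := h.range
    rw [k.2] at hr
    obtain ⟨i, rfl⟩ := Int.eq_ofNat_of_zero_le hr.1
    have h1 := hl ⟨i, by omega⟩
    have h2 := hl ⟨i + 1, by omega⟩
    simp only at h1 h2
    exact labelOf_lt_succ_iff.1 (h1 ▸ h2 ▸ labelOf_lt_succ_iff.2 h)
  exact Subtype.ext (ext_of_edge (k.2.trans k'.2.symm)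
    (fun x y => ⟨hE k k' hg x y, hE k' k hg.symm x y⟩)
    fun i => ⟨hB k k' hl i, hB k' k (fun i => (hl i).symm) i⟩)

end Code

namespace Tree

variable {n : ℕ} (T : Tree n)

theorem label_zero : T.label 0 = 1 := by
  obtain ⟨w, hw⟩ := T.label_closed 0 1 le_rfl (T.label_pos 0)
  exact le_antisymm ((T.label_mono (Fin.zero_le w)).trans hw.le) (T.label_pos 0)

/-- By monotonicity, a vertex carrying a skipped value would lie strictly between two neighbours. -/
theorem label_succ_le (i : Fin n) : T.label i.succ ≤ T.label i.castSucc + 1 := by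
  by_contra! h
  obtain ⟨w, hw⟩ := T.label_closed i.succ (T.label i.castSucc + 1) (by omega) (by omega)
  rcases le_or_gt w i.castSucc with h' | h'
  · have := T.label_mono h'; omega
  · have := T.label_mono (Fin.castSucc_lt_iff_succ_le.1 h')
    omega

/-- The edges of `T`, as a relation on integers. -/
def Rel (x y : ℤ) : Prop :=
  ∃ i j : Fin (n + 1), ((i : ℕ) : ℤ) = x ∧ ((j : ℕ) : ℤ) = y ∧ T.graph.Adj i j

theorem rel_iff {i j : Fin (n + 1)} : T.Rel (i : ℕ) (j : ℕ) ↔ T.graph.Adj i j := by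
  refine ⟨fun ⟨a, b, ha, hb, h⟩ => ?_, fun h => ⟨i, j, rfl, rfl, h⟩⟩
  have ha : a = i := Fin.ext (by exact_mod_cast ha)
  have hb : b = j := Fin.ext (by exact_mod_cast hb)
  rwa [ha, hb] at h

theorem acyclicRel : AcyclicRel T.Rel := by
  rintro _ _ ⟨a, c, rfl, rfl, hac⟩ h
  refine SimpleGraph.isBridge_iff.1
    (SimpleGraph.isAcyclic_iff_forall_adj_isBridge.1 T.isTree.isAcyclic hac) ?_
  suffices ∀ z : ℤ, ReflTransGen (fun x y => T.Rel x y ∧ ¬ (x = (a : ℕ) ∧ y = (c : ℕ)) ∧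
      ¬ (x = (c : ℕ) ∧ y = (a : ℕ))) (a : ℕ) z → ∀ w : Fin (n + 1), ((w : ℕ) : ℤ) = z →
      (T.graph.deleteEdges {s(a, c)}).Reachable a w from this _ h c rfl
  intro z hz
  induction hz with
  | refl =>
    intro w hw
    have : w = a := Fin.ext (by exact_mod_cast hw)
    rw [this]
  | tail _ hyz ih =>
    rintro w rfl
    obtain ⟨⟨i, j, rfl, hj, hij⟩, h1, h2⟩ := hyz
    have hj : j = w := Fin.ext (by exact_mod_cast hj)
    subst hj
    refine (ih i rfl).trans (SimpleGraph.Adj.reachable ?_)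
    rw [SimpleGraph.deleteEdges_adj]
    refine ⟨hij, fun h => ?_⟩
    rw [Set.mem_singleton_iff, Sym2.eq_iff] at h
    rcases h with ⟨rfl, rfl⟩ | ⟨rfl, rfl⟩
    · exact h1 ⟨rfl, rfl⟩
    · exact h2 ⟨rfl, rfl⟩

theorem exists_code : ∃ k : {k : Code // k.size = n}, Code.toTree k = T := by
  obtain ⟨k, hk, hE, hB⟩ := GNC.exists_code n T.Rel
    (fun g => ∃ i : Fin n, ((i : ℕ) : ℤ) = g ∧ T.label i.castSucc < T.label i.succ)
    (fun _ _ ⟨i, j, hi, hj, h⟩ => ⟨j, i, hj, hi, h.symm⟩) T.acyclicRel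
    (by
      rintro _ _ _ _ h1 h2 h3 ⟨a, c, rfl, rfl, hac⟩ ⟨b, e, rfl, rfl, hbe⟩
      exact T.noncrossing a b c e (by exact_mod_cast h1) (by exact_mod_cast h2)
        (by exact_mod_cast h3) ⟨hac, hbe⟩)
    (fun x h0 h1 => by
      obtain ⟨x, rfl⟩ := Int.eq_ofNat_of_zero_le h0
      have := (SimpleGraph.reachable_iff_reflTransGen _ _).1
        (T.isTree.connected.preconnected 0 ⟨x, by omega⟩)
      exact this.lift (p := Within T.Rel 0 n) (fun i : Fin (n + 1) => ((i : ℕ) : ℤ))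
        fun i j hij => ⟨T.rel_iff.2 hij, by dsimp only; omega⟩)
  refine ⟨⟨k, hk⟩, Tree.ext ?_ (funext fun i => ?_)⟩
  · ext i j
    rw [← T.rel_iff]
    exact (hE _ _ (by omega) (by omega) (by omega) (by omega)).symm
  · show labelOf k.Bar i = T.label i
    induction i using Fin.induction with
    | zero => simp [labelOf, T.label_zero]
    | succ i ih =>
      have h1 := T.label_succ_le i
      have h2 := T.label_mono (Fin.castSucc_lt_succ (i := i)).le
      have h3 := hB (i : ℕ) (by omega) (by omega)
      simp only [Fin.val_castSucc, Fin.val_succ] at ih ⊢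
      simp only [labelOf, ih]
      split_ifs with hb
      · obtain ⟨j, hj, hj'⟩ := h3.2 hb
        have hj : j = i := Fin.ext (by exact_mod_cast hj)
        subst hj
        omega
      · have : ¬ T.label i.castSucc < T.label i.succ := fun h => hb (h3.1 ⟨i, rfl, h⟩)
        omega

end Tree

end GNC

/-! ### Avoidance and edge counts in terms of codes -/

namespace GNC

open Relation

theorem letter_eq_u {i j : ℕ} : letter i j = Letter.u ↔ i < j := by
  unfold letter; split_ifs <;> simp_all

theorem letter_eq_d {i j : ℕ} : letter i j = Letter.d ↔ j < i := by
  unfold letter; split_ifs <;> simp <;> omega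

namespace Tree

variable {n : ℕ} (T : Tree n)

theorem word_concat {a b c : Fin (n + 1)} (p : T.graph.Walk a b) (h : T.graph.Adj b c) :
    T.word (p.concat h) = T.word p ++ [letter (T.label b) (T.label c)] := by
  induction p with
  | nil => rfl
  | cons h' p ih => simp [SimpleGraph.Walk.concat_cons, word, ih]

/-- The path from the root to a either passes through b or extends to a path to b. -/
theorem arc_or_arc {a b : Fin (n + 1)} (h : T.graph.Adj a b) : T.Arc a b ∨ T.Arc b a := by
  obtain ⟨p, hp, -⟩ := T.isTree.existsUnique_path 0 a
  by_cases hb : b ∈ p.support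
  · exact Or.inr ⟨h.symm, p, hp, hb⟩
  · exact Or.inl ⟨h, p.concat h, hp.concat hb h, by simp [SimpleGraph.Walk.support_concat]⟩

theorem count_eq_zero_iff (s : Letter) :
    T.count s = 0 ↔ ∀ a b, T.Arc a b → letter (T.label a) (T.label b) ≠ s := by
  rw [count, Set.ncard_eq_zero (Set.toFinite _), Set.eq_empty_iff_forall_notMem]
  exact ⟨fun h a b hab hs => h (a, b) ⟨hab, hs⟩, fun h e he => h e.1 e.2 he.1 he.2⟩

end Tree

namespace Code

/-- By uniqueness of parents, a directed cycle through a vertex yields one through its parent, and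
so finally one through 0, which has no parent. -/
theorem Arc.not_transGen {k : Code} {y : ℤ} (h0 : 0 ≤ y) (hy : y ≤ k.size) :
    ¬ TransGen k.Arc y y := by
  have := k.reach h0 hy
  clear h0 hy
  induction this with
  | refl =>
    intro h
    obtain ⟨x, -, h⟩ := TransGen.tail'_iff.1 h
    have := h.range
    omega
  | tail _ h ih =>
    intro h'
    obtain ⟨x, hx, hxy⟩ := TransGen.tail'_iff.1 h'
    rw [hxy.parent_unique h] at hx
    exact ih (TransGen.head' h hx)

section

variable {n : ℕ} (k : {k : Code // k.size = n})

/-- Recording that the support consists of ancestors is what shows, by acyclicity, that each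
extension is again a path. -/
theorem exists_path (x : ℤ) (hx : ReflTransGen k.1.Arc 0 x) :
    ∀ j : Fin (n + 1), ((j : ℕ) : ℤ) = x → ∃ p : (toTree k).graph.Walk 0 j,
      p.IsPath ∧ ∀ v ∈ p.support, ReflTransGen k.1.Arc (v : ℕ) x := by
  induction hx with
  | refl =>
    intro j hj
    have : j = 0 := Fin.ext (by simpa using hj)
    subst this
    exact ⟨SimpleGraph.Walk.nil, by simp, by simp [ReflTransGen.refl]⟩
  | @tail y z hy hyz ih =>
    rintro j rfl
    have hr := hyz.range
    have hk := k.2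
    obtain ⟨y, rfl⟩ := Int.eq_ofNat_of_zero_le hr.1
    obtain ⟨p, hp, hp'⟩ := ih ⟨y, by omega⟩ rfl
    have hadj : (toTree k).graph.Adj ⟨y, by omega⟩ j := Or.inl hyz
    refine ⟨p.concat hadj, hp.concat (fun hj => ?_) hadj, fun v hv => ?_⟩
    · exact Arc.not_transGen (by omega) (by omega) (TransGen.tail' (hp' j hj) hyz)
    · rw [SimpleGraph.Walk.support_concat, List.mem_append,
        List.mem_singleton] at hv
      rcases hv with hv | rfl
      · exact (hp' v hv).tail hyz
      · exact ReflTransGen.refl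

/-- A path that does not return to the parent of its first vertex leads away from the root. -/
theorem exists_arc_of_infix {v w : Fin (n + 1)} (p : (toTree k).graph.Walk v w) (hp : p.IsPath)
    (hv : ∀ x ∈ p.support, ¬ k.1.Arc (x : ℕ) (v : ℕ)) {s t : Letter}
    (h : [s, t] <:+: (toTree k).word p) :
    ∃ x y z : Fin (n + 1), k.1.Arc (x : ℕ) (y : ℕ) ∧ k.1.Arc (y : ℕ) (z : ℕ) ∧
      letter ((toTree k).label x) ((toTree k).label y) = s ∧
      letter ((toTree k).label y) ((toTree k).label z) = t := by
  induction p with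
  | nil => simp [Tree.word] at h
  | @cons v u w hvu p ih =>
    rw [SimpleGraph.Walk.cons_isPath_iff] at hp
    have harc : k.1.Arc (v : ℕ) (u : ℕ) :=
      Or.resolve_right hvu (hv u (by simp))
    have hu : ∀ x ∈ p.support, ¬ k.1.Arc (x : ℕ) (u : ℕ) := by
      intro x hx hxu
      have : x = v := Fin.ext (by exact_mod_cast hxu.parent_unique harc)
      exact hp.2 (this ▸ hx)
    rw [Tree.word, List.infix_cons_iff] at h
    rcases h with h | h
    · rw [List.cons_prefix_cons] at h
      cases p with
      | nil => simp [Tree.word] at h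
      | @cons _ u' _ huu' p =>
        rw [Tree.word, List.cons_prefix_cons] at h
        exact ⟨v, u, u', harc, Or.resolve_right huu' (hu u' (by simp)), h.1.symm, h.2.1.symm⟩
    · exact ih hp.1 hu h

/-- The root has no parent, so a path from it always leads away from it; conversely, two consecutive
arcs prolong the path from the root to the first tail. -/
theorem contains_pair_iff {s t : Letter} :
    (toTree k).Contains [s, t] ↔
      ∃ x y z : Fin (n + 1), k.1.Arc (x : ℕ) (y : ℕ) ∧ k.1.Arc (y : ℕ) (z : ℕ) ∧
        letter ((toTree k).label x) ((toTree k).label y) = s ∧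
        letter ((toTree k).label y) ((toTree k).label z) = t := by
  constructor
  · rintro ⟨v, p, hp, h⟩
    refine exists_arc_of_infix k p hp (fun x _ hx => ?_) h
    have := hx.range
    simp at this
  · rintro ⟨x, y, z, hxy, hyz, rfl, rfl⟩
    have hk := k.2
    have hx := hxy.range
    have hz := hyz.range
    obtain ⟨p, hp, hp'⟩ := exists_path k _ (k.1.reach hx.1 hx.2.1) x rfl
    have h1 : (toTree k).graph.Adj x y := Or.inl hxy
    have h2 : (toTree k).graph.Adj y z := Or.inl hyz
    refine ⟨z, (p.concat h1).concat h2, (hp.concat (fun h => ?_) h1).concat (fun h => ?_) h2, ?_⟩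
    · exact Arc.not_transGen (by omega) (by omega) (TransGen.tail' (hp' _ h) hxy)
    · rw [SimpleGraph.Walk.support_concat, List.mem_append,
        List.mem_singleton] at h
      rcases h with h | rfl
      · exact Arc.not_transGen (by omega) (by omega) (TransGen.tail' ((hp' _ h).tail hxy) hyz)
      · exact hyz.not_symm hyz
    · rw [Tree.word_concat, Tree.word_concat, List.append_assoc]
      exact (List.suffix_append _ _).isInfix

theorem avoids_iff : (toTree k).Avoids uuDd ↔ k.1.Good := by
  have hl : ∀ x y : Fin (n + 1), (toTree k).label x < (toTree k).label y ↔
      k.1.Jump (x : ℕ) (y : ℕ) := fun x y => labelOf_lt_iff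
  have : (toTree k).Avoids uuDd ↔ ∀ x y z : Fin (n + 1), k.1.Arc (x : ℕ) (y : ℕ) →
      k.1.Arc (y : ℕ) (z : ℕ) → ¬ (k.1.Jump (x : ℕ) (y : ℕ) ∧ k.1.Jump (y : ℕ) (z : ℕ)) ∧
        ¬ (k.1.Jump (y : ℕ) (x : ℕ) ∧ k.1.Jump (z : ℕ) (y : ℕ)) := by
    simp only [Tree.Avoids, uuDd, Set.mem_insert_iff, Set.mem_singleton_iff, forall_eq_or_imp,
      forall_eq, contains_pair_iff, letter_eq_u, letter_eq_d, hl]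
    grind
  rw [this]
  refine ⟨fun h x y z hxy hyz => ?_, fun h x y z => h _ _ _⟩
  have hk := k.2
  have hx := hxy.range
  have hz := hyz.range
  obtain ⟨x, rfl⟩ := Int.eq_ofNat_of_zero_le hx.1
  obtain ⟨y, rfl⟩ := Int.eq_ofNat_of_zero_le hz.1
  obtain ⟨z, rfl⟩ := Int.eq_ofNat_of_zero_le (show 0 ≤ z by omega)
  exact h ⟨x, by omega⟩ ⟨y, by omega⟩ ⟨z, by omega⟩ hxy hyz

/-- If all edges are level, connectivity makes the labels constant, whereas any marked gap separates
the labels of the first and last vertices. -/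
theorem count_eq_zero_iff_flat :
    (toTree k).count Letter.u = 0 ∧ (toTree k).count Letter.d = 0 ↔ k.1.Flat := by
  have hl : ∀ x y : Fin (n + 1), (toTree k).label x < (toTree k).label y ↔
      k.1.Jump (x : ℕ) (y : ℕ) := fun x y => labelOf_lt_iff
  simp only [Tree.count_eq_zero_iff, ne_eq, letter_eq_u, letter_eq_d]
  constructor
  · rintro ⟨h1, h2⟩ g hg
    have hle : ∀ x y, (toTree k).Arc x y → (toTree k).label x = (toTree k).label y :=
      fun x y h => le_antisymm (not_lt.1 (h2 x y h)) (not_lt.1 (h1 x y h))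
    have hadj : ∀ x y, (toTree k).graph.Adj x y → (toTree k).label x = (toTree k).label y :=
      fun x y h => ((toTree k).arc_or_arc h).elim (hle x y) fun h => (hle y x h).symm
    have hconst : ∀ y, (toTree k).label 0 = (toTree k).label y := by
      intro y
      have := (SimpleGraph.reachable_iff_reflTransGen _ _).1
        ((toTree k).isTree.connected.preconnected 0 y)
      induction this with
      | refl => rfl
      | tail _ h ih => exact ih.trans (hadj _ _ h)
    have hr := hg.range
    have hk := k.2
    have : (toTree k).label 0 < (toTree k).label (Fin.last n) :=
      (hl _ _).2 ⟨g, by simpa using hr.1, by simp; omega, hg⟩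
    exact this.ne (hconst _)
  · intro h
    exact ⟨fun x y _ hxy => h.not_jump ((hl x y).1 hxy),
      fun x y _ hxy => h.not_jump ((hl y x).1 hxy)⟩

end

theorem sum_tree (n : ℕ) (F : Tree n → ℤ) (f : Code → ℤ)
    (h : ∀ k : {k : Code // k.size = n}, F (toTree k) = f k) :
    ∑ T : Tree n, F T = ∑ k ∈ ofSize n, f k := by
  refine (Finset.sum_bij (fun k hk => toTree ⟨k, mem_ofSize.1 hk⟩) (fun _ _ => Finset.mem_univ _)
    (fun k hk k' hk' e => congrArg Subtype.val (toTree_injective n e)) (fun T _ => ?_)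
    fun k hk => ?_).symm
  · obtain ⟨k, hk⟩ := T.exists_code
    exact ⟨k.1, mem_ofSize.2 k.2, hk⟩
  · exact (h ⟨k, mem_ofSize.1 hk⟩).symm

end Code

open Classical in
theorem genFun_uuDd : genFun uuDd 1 1 1 = Code.gf fun k => if k.Good then 1 else 0 := by
  ext n
  simp only [genFun, Code.gf, PowerSeries.coeff_mk, one_pow, mul_one, Finset.sum_filter]
  exact Code.sum_tree n _ _ fun k => if_congr (Code.avoids_iff k) rfl rfl

open Classical in
-- Since 0^0 = 1, the weight at (0, 1, 0) is the indicator of having neither ascents nor descents.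
theorem genFun_level : genFun ∅ 0 1 0 = Code.gf fun k => if k.Flat then 1 else 0 := by
  ext n
  simp only [genFun, Code.gf, PowerSeries.coeff_mk, Finset.sum_filter]
  refine Code.sum_tree n _ _ fun k => ?_
  have hA : (Code.toTree k).Avoids ∅ := fun σ hσ => hσ.elim
  rw [if_pos hA, if_congr (Code.count_eq_zero_iff_flat k).symm rfl rfl]
  by_cases h1 : (Code.toTree k).count Letter.u = 0 <;>
    by_cases h2 : (Code.toTree k).count Letter.d = 0 <;> simp [h1, h2]

end GNC

theorem mainTheorem12 :
    GNC.genFun GNC.uuDd 1 1 1 =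
      (1 + PowerSeries.X * GNC.genFun ∅ 0 1 0 ^ 2 * GNC.genFun GNC.uuDd 1 1 1) *
        (1 - PowerSeries.X * GNC.genFun ∅ 0 1 0 ^ 2 +
          2 * PowerSeries.X * GNC.genFun GNC.uuDd 1 1 1 ^ 2) := by
  rw [GNC.genFun_uuDd, GNC.genFun_level]
  exact GNC.Code.gf_good
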